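/- Let $K$ be a field. A dialgebra over $K$ is a $K$-module with two bilinear products $\dashv,\vdash$ satisfying $x\dashv(y\dashv z)=(x\dashv y)\dashv z=x\dashv(y\vdash z)$, $(x\vdash y)\dashv z=x\vdash(y\dashv z)$ and $(x\dashv y)\vdash z=x\vdash(y\vdash z)=(x\vdash y)\vdash z$. A morphism of dialgebras is a $K$-linear map respecting both products, and a representation $M$ of $D$ is a $K$-module with left and right actions $\dashv,\vdash$ of $D$ satisfying the fifteen axioms obtained by taking one of $x,y,z$ in $M$. Let $Y_n$ be the set of planar binary trees with $n+1$ leaves (numbered $0,\dots,n$ from left to right), $d_i$ the deletion of the $i$th leaf, and $\vee$ the grafting of trees. For a representation $M$ of $D$ put $CY^n(D,M)=\operatorname{Hom}_K(K[Y_n]\otimes D^{\otimes n},M)$ and $\delta=\sum_{i=0}^{n+1}(-1)^i\delta^i\colon CY^n(D,M)\to CY^{n+1}(D,M)$, where $(\delta^i f)(y\otimes(a_1,\dots,a_{n+1}))$ is $a_1\circ_0^y f(d_0y\otimes(a_2,\dots,a_{n+1}))$ for $i=0$, $f(d_iy\otimes(\dots,a_{i-1},a_i\circ_i^y a_{i+1},a_{i+2},\dots))$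 for $1\le i\le n$, and $f(d_{n+1}y\otimes(a_1,\dots,a_n))\circ_{n+1}^y a_{n+1}$ for $i=n+1$. Here $\circ_0^y$ is $\dashv$ if $y=|\vee y'$ for some tree $y'$ and $\vdash$ otherwise; $\circ_{n+1}^y$ is $\vdash$ if $y=y'\vee|$ for some tree $y'$ and $\dashv$ otherwise; for $1\le i\le n$, $\circ_i^y$ is $\dashv$ if the $i$th leaf is a left child (points like $\backslash$) and $\vdash$ if it is a right child (points like $/$). For $f\in CY^{m+1}(D,D)$ and $g\in CY^{n+1}(D,D)$ the pre-Lie product is $f\circ g=\sum_{i=0}^{m}(-1)^{ni}f\circ_i g\in CY^{m+n+1}(D,D)$, with $$(f\circ_i g)(y\otimes(a_0,\dots,a_{m+n}))=f\bigl(y'\otimes(a_0,\dots,a_{i-1},g(y''\otimes(a_i,\dots,a_{i+n})),a_{i+n+1},\dots,a_{m+n})\bigr),$$ where $y'$ is $y$ with the leaves $i+1,\dots,i+n$ deleted and $y''$ is $y$ with only the leaves $i,\dots,i+n+1$ kept. A pair of bilinear maps $F=(F^l;F^r)$ is identified with the $2$-cochain equal to $F^l$ on the tree $[21]=|\vee(|\vee|)$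 and to $F^r$ on $[12]=(|\vee|)\vee|$. Let $\psi\colon D\to E$ be a morphism of dialgebras over $K$, and regard $E$ as a representation of $D$ via $\psi$. The deformation complex of $\psi$ is $CY^n(\psi,\psi)=CY^n(D,D)\times CY^n(E,E)\times CY^{n-1}(D,E)$ (with $CY^{-1}=0$) and $\delta(\xi;\pi;\varphi)=(\delta\xi;\delta\pi;\psi\xi-\pi\psi-\delta\varphi)$, where $(\psi\xi)(y\otimes(a_1,\dots,a_n))=\psi(\xi(y\otimes(a_1,\dots,a_n)))$ and $(\pi\psi)(y\otimes(a_1,\dots,a_n))=\pi(y\otimes(\psi(a_1),\dots,\psi(a_n)))$. Let $N$ be a positive integer. A deformation of order $N$ of $\psi$ is a triple $\Theta_t=(f_{D,t};f_{E,t};\Psi_t)$, where $f_{D,t}=\sum_{i=0}^N(F^l_{D,i};F^r_{D,i})t^i$ and $f_{E,t}=\sum_{i=0}^N(F^l_{E,i};F^r_{E,i})t^i$ have bilinear coefficients, start with the given products ($F^l_{\cdot,0}=\dashv$, $F^r_{\cdot,0}=\vdash$) and satisfy the dialgebra axioms modulo $t^{N+1}$, and $\Psi_t=\sum_{i=0}^N\psi_it^i$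 has linear coefficients $\psi_i\colon D\to E$, $\psi_0=\psi$, and satisfies $\Psi_t(f^*_{D,t}(a,b))\equiv f^*_{E,t}(\Psi_t(a),\Psi_t(b))\pmod{t^{N+1}}$ for $a,b\in D$ and $*\in\{l,r\}$. Its obstruction class is $\mathrm{Ob}(\Theta_t)=(\mathrm{Ob}_D;\mathrm{Ob}_E;\mathrm{Ob}_\psi)\in CY^3(\psi,\psi)$, where $$\mathrm{Ob}_D=\sum_{i+j=N+1,\ i,j>0}F_{D,i}\circ F_{D,j},\qquad \mathrm{Ob}_E=\sum_{i+j=N+1,\ i,j>0}F_{E,i}\circ F_{E,j},$$ and $\mathrm{Ob}_\psi\in CY^2(D,E)$ is given by the pair of bilinear maps $$\mathrm{Ob}_\psi^*(a,b)=\sum{}' F^*_{E,i}(\psi_j(a),\psi_k(b))-\sum_{i=1}^N\psi_iF^*_{D,N+1-i}(a,b),\qquad *\in\{l,r\},$$ where $\sum'$ runs over the triples $i,j,k\ge0$ with $i+j+k=N+1$ of which at least two are positive. Lemma. For every morphism $\psi$ of dialgebras over $K$, every $N\ge1$ and every deformation $\Theta_t$ of order $N$ of $\psi$, the obstruction class $\mathrm{Ob}(\Theta_t)$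 is a $3$-cocycle: $\delta\,\mathrm{Ob}(\Theta_t)=0$ in $CY^4(\psi,\psi)$. -/

import Mathlib

namespace YauDialg

universe u v w

/-! ### Planar binary trees -/

/-- `left` stands for the left product `⊣`, `right` for the right product `⊢`. -/
inductive Side : Type
  | left
  | right
  deriving DecidableEq

/-- `deleteLeaf t i` deletes the `i`th leaf of `t` (leaves are numbered `0, 1, 2, …` from left to
right); the internal node above that leaf is contracted. -/
def deleteLeaf : BinaryTree Unit → ℕ → BinaryTree Unit
  | .nil, _ => .nil
  | .node _ l r, i =>
    if i < l.numLeaves then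
      if l = .nil then r else .node () (deleteLeaf l i) r
    else
      if r = .nil then l else .node () l (deleteLeaf r (i - l.numLeaves))

theorem numNodes_deleteLeaf (t : BinaryTree Unit) (i : ℕ) :
    (deleteLeaf t i).numNodes = t.numNodes - 1 := by
  induction t generalizing i with
  | nil => rfl
  | node u l r hl hr =>
    have pos : ∀ s : BinaryTree Unit, s ≠ .nil → 0 < s.numNodes := by
      intro s hs
      cases s with
      | nil => exact absurd rfl hs
      | node _ _ _ => simp
    unfold deleteLeaf
    split_ifs with h1 h2 h3
    · subst h2; simp
    · have := pos l h2
      simp only [BinaryTree.numNodes, hl]; omega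
    · subst h3; simp
    · have := pos r h3
      simp only [BinaryTree.numNodes, hr]; omega

theorem numNodes_iterate_deleteLeaf (t : BinaryTree Unit) (i k : ℕ) :
    ((fun s => deleteLeaf s i)^[k] t).numNodes = t.numNodes - k := by
  induction k with
  | zero => rfl
  | succ k ih =>
    rw [Function.iterate_succ_apply', numNodes_deleteLeaf, ih]; omega

/-- The set `Y_n` of `n`-trees: planar binary trees with `n` internal nodes, i.e. `n + 1` leaves. -/
abbrev Y (n : ℕ) : Type := {t : BinaryTree Unit // t.numNodes = n}

/-- The face map `d_i : Y_{n+1} → Y_n`, `0 ≤ i ≤ n + 1`, deleting the `i`th leaf. -/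
def Y.d {n : ℕ} (i : Fin (n + 2)) (y : Y (n + 1)) : Y n :=
  ⟨deleteLeaf y.1 i, by rw [numNodes_deleteLeaf, y.2]; rfl⟩

/-- Is leaf `i` the left child of the node it is attached to (a leaf pointing like `\`)? -/
def leafIsLeftChild : BinaryTree Unit → ℕ → Bool
  | .nil, _ => false
  | .node _ l r, i =>
    if i < l.numLeaves then
      if l = .nil then true else leafIsLeftChild l i
    else
      if r = .nil then false else leafIsLeftChild r (i - l.numLeaves)

/-- `∘_0^y`: it is `⊣` if `y = | ∨ y'` (the leftmost leaf is attached to the root), else `⊢`. -/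
def opFirst : BinaryTree Unit → Side
  | .node _ .nil _ => .left
  | _ => .right

/-- `∘_{n+1}^y`: it is `⊢` if `y = y' ∨ |` (the rightmost leaf is attached to the root), else `⊣`. -/
def opLast : BinaryTree Unit → Side
  | .node _ _ .nil => .right
  | _ => .left

/-- `∘_i^y` for an inner leaf `i`: it is `⊣` if the `i`th leaf points like `\` and `⊢` if it points
like `/`. -/
def opInner (t : BinaryTree Unit) (i : ℕ) : Side :=
  if leafIsLeftChild t i then .left else .right

/-- The product attached to a `2`-tree: `⊣` for `[21] = | ∨ [1]`, and `⊢` for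
`[12] = [1] ∨ |`. -/
def treeSide (y : Y 2) : Side :=
  if y.1 = .node () .nil (.node () .nil .nil) then .left else .right

/-- For `y ∈ Y_{m+n+1}` and a block of `n + 1` consecutive inputs `i, …, i + n` (counted from `0`;
input `j` lies between the leaves `j` and `j + 1`): the tree in `Y_{m+1}` obtained from `y` by
deleting the leaves `i + 1, …, i + n` in the interior of the block. -/
def Y.outer {m n : ℕ} (i : Fin (m + 1)) (y : Y (m + n + 1)) : Y (m + 1) :=
  ⟨(fun s => deleteLeaf s (i + 1))^[n] y.1, by
    rw [numNodes_iterate_deleteLeaf, y.2]; omega⟩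

/-- For `y ∈ Y_{m+n+1}` and a block of `n + 1` consecutive inputs `i, …, i + n`: the tree in
`Y_{n+1}` obtained from `y` by keeping only the leaves `i, …, i + n + 1`. -/
def Y.inner {m n : ℕ} (i : Fin (m + 1)) (y : Y (m + n + 1)) : Y (n + 1) :=
  ⟨(fun s => deleteLeaf s 0)^[(i : ℕ)] ((fun s => deleteLeaf s (i + n + 2))^[m - i] y.1), by
    rw [numNodes_iterate_deleteLeaf, numNodes_iterate_deleteLeaf, y.2]; omega⟩

/-! ### Dialgebras, morphisms, representations -/

/-- A dialgebra over `K`: a `K`-module with bilinear products `mul left = ⊣` and `mul right = ⊢`. -/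
class Dialgebra (K : Type*) (D : Type*) [Field K] [AddCommGroup D] [Module K D] where
  mul : Side → D →ₗ[K] D →ₗ[K] D
  axiom₁ : ∀ x y z, mul .left x (mul .left y z) = mul .left (mul .left x y) z
  axiom₂ : ∀ x y z, mul .left (mul .left x y) z = mul .left x (mul .right y z)
  axiom₃ : ∀ x y z, mul .left (mul .right x y) z = mul .right x (mul .left y z)
  axiom₄ : ∀ x y z, mul .right (mul .left x y) z = mul .right x (mul .right y z)
  axiom₅ : ∀ x y z, mul .right x (mul .right y z) = mul .right (mul .right x y) z

/-- A morphism of dialgebras: a `K`-linear map respecting both products. -/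
structure DialgebraHom (K D E : Type*) [Field K] [AddCommGroup D] [Module K D] [Dialgebra K D]
    [AddCommGroup E] [Module K E] [Dialgebra K E] where
  toLin : D →ₗ[K] E
  map_mul : ∀ (s : Side) (a b : D),
    toLin (Dialgebra.mul (K := K) s a b) = Dialgebra.mul (K := K) s (toLin a) (toLin b)

/-- A representation of the dialgebra `D`: left actions `lact s : D ⊗ M → M` and right actions
`ract s : M ⊗ D → M`, with the fifteen axioms obtained from the five dialgebra axioms by taking
one of `x, y, z` from `M` (suffix `z`, `y` or `x`). -/
structure Rep (K D M : Type*) [Field K] [AddCommGroup D] [Module K D] [Dialgebra K D]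
    [AddCommGroup M] [Module K M] where
  lact : Side → D →ₗ[K] M →ₗ[K] M
  ract : Side → M →ₗ[K] D →ₗ[K] M
  axiom₁z : ∀ (x y : D) (z : M),
    lact .left x (lact .left y z) = lact .left (Dialgebra.mul (K := K) .left x y) z
  axiom₂z : ∀ (x y : D) (z : M),
    lact .left (Dialgebra.mul (K := K) .left x y) z = lact .left x (lact .right y z)
  axiom₃z : ∀ (x y : D) (z : M),
    lact .left (Dialgebra.mul (K := K) .right x y) z = lact .right x (lact .left y z)
  axiom₄z : ∀ (x y : D) (z : M),
    lact .right (Dialgebra.mul (K := K) .left x y) z = lact .right x (lact .right y z)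
  axiom₅z : ∀ (x y : D) (z : M),
    lact .right x (lact .right y z) = lact .right (Dialgebra.mul (K := K) .right x y) z
  axiom₁y : ∀ (x : D) (y : M) (z : D),
    lact .left x (ract .left y z) = ract .left (lact .left x y) z
  axiom₂y : ∀ (x : D) (y : M) (z : D),
    ract .left (lact .left x y) z = lact .left x (ract .right y z)
  axiom₃y : ∀ (x : D) (y : M) (z : D),
    ract .left (lact .right x y) z = lact .right x (ract .left y z)
  axiom₄y : ∀ (x : D) (y : M) (z : D),
    ract .right (lact .left x y) z = lact .right x (ract .right y z)
  axiom₅y : ∀ (x : D) (y : M) (z : D),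
    lact .right x (ract .right y z) = ract .right (lact .right x y) z
  axiom₁x : ∀ (x : M) (y z : D),
    ract .left x (Dialgebra.mul (K := K) .left y z) = ract .left (ract .left x y) z
  axiom₂x : ∀ (x : M) (y z : D),
    ract .left (ract .left x y) z = ract .left x (Dialgebra.mul (K := K) .right y z)
  axiom₃x : ∀ (x : M) (y z : D),
    ract .left (ract .right x y) z = ract .right x (Dialgebra.mul (K := K) .left y z)
  axiom₄x : ∀ (x : M) (y z : D),
    ract .right (ract .left x y) z = ract .right x (Dialgebra.mul (K := K) .right y z)
  axiom₅x : ∀ (x : M) (y z : D),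
    ract .right x (Dialgebra.mul (K := K) .right y z) = ract .right (ract .right x y) z

section

variable {K D E M : Type*} [Field K] [AddCommGroup D] [Module K D] [Dialgebra K D]
  [AddCommGroup E] [Module K E] [Dialgebra K E] [AddCommGroup M] [Module K M]

/-- `E` as a representation of `D` via a dialgebra morphism `ψ : D → E`. -/
def DialgebraHom.rep (ψ : DialgebraHom K D E) : Rep K D E where
  lact s := (Dialgebra.mul (K := K) s).comp ψ.toLin
  ract s := (Dialgebra.mul (K := K) s).compl₂ ψ.toLin
  axiom₁z x y z := by simp [ψ.map_mul, Dialgebra.axiom₁]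
  axiom₂z x y z := by simp [ψ.map_mul, Dialgebra.axiom₂]
  axiom₃z x y z := by simp [ψ.map_mul, Dialgebra.axiom₃]
  axiom₄z x y z := by simp [ψ.map_mul, Dialgebra.axiom₄]
  axiom₅z x y z := by simp [ψ.map_mul, Dialgebra.axiom₅]
  axiom₁y x y z := by simp [Dialgebra.axiom₁]
  axiom₂y x y z := by simp [Dialgebra.axiom₂]
  axiom₃y x y z := by simp [Dialgebra.axiom₃]
  axiom₄y x y z := by simp [Dialgebra.axiom₄]
  axiom₅y x y z := by simp [Dialgebra.axiom₅]
  axiom₁x x y z := by simp [ψ.map_mul, Dialgebra.axiom₁]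
  axiom₂x x y z := by simp [ψ.map_mul, Dialgebra.axiom₂]
  axiom₃x x y z := by simp [ψ.map_mul, Dialgebra.axiom₃]
  axiom₄x x y z := by simp [ψ.map_mul, Dialgebra.axiom₄]
  axiom₅x x y z := by simp [ψ.map_mul, Dialgebra.axiom₅]

variable (K D) in
/-- A dialgebra is a representation of itself. -/
def Rep.self : Rep K D D where
  lact := Dialgebra.mul
  ract := Dialgebra.mul
  axiom₁z := Dialgebra.axiom₁
  axiom₂z := Dialgebra.axiom₂
  axiom₃z := Dialgebra.axiom₃
  axiom₄z := Dialgebra.axiom₄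
  axiom₅z := Dialgebra.axiom₅
  axiom₁y := Dialgebra.axiom₁
  axiom₂y := Dialgebra.axiom₂
  axiom₃y := Dialgebra.axiom₃
  axiom₄y := Dialgebra.axiom₄
  axiom₅y := Dialgebra.axiom₅
  axiom₁x := Dialgebra.axiom₁
  axiom₂x := Dialgebra.axiom₂
  axiom₃x := Dialgebra.axiom₃
  axiom₄x := Dialgebra.axiom₄
  axiom₅x := Dialgebra.axiom₅

end

/-! ### Multilinear bookkeeping -/

theorem update_succ_comp {D : Type*} {n : ℕ} (a : Fin (n + 1) → D) (j : Fin n) (x : D) :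
    (fun k : Fin n => Function.update a j.succ x k.succ)
      = Function.update (fun k : Fin n => a k.succ) j x := by
  funext k; simp [Function.update_apply]

theorem update_castSucc_comp {D : Type*} {n : ℕ} (a : Fin (n + 1) → D) (j : Fin n) (x : D) :
    (fun k : Fin n => Function.update a j.castSucc x k.castSucc)
      = Function.update (fun k : Fin n => a k.castSucc) j x := by
  funext k; simp [Function.update_apply]

section

variable {K D M : Type*} [Field K] [AddCommGroup D] [Module K D] [AddCommGroup M] [Module K M]

/-- A bilinear map as a multilinear map in two variables. -/
def bilin (B : D →ₗ[K] D →ₗ[K] M) : MultilinearMap K (fun _ : Fin 2 => D) M where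
  toFun a := B (a 0) (a 1)
  map_update_add' := by
    intro inst a i x y
    rw [Subsingleton.elim inst (instDecidableEqFin 2)]
    fin_cases i <;> simp
  map_update_smul' := by
    intro inst a i c x
    rw [Subsingleton.elim inst (instDecidableEqFin 2)]
    fin_cases i <;> simp

/-- The argument list of `F` when `G` is inserted in slot `i`:
`(a_0, …, a_{i-1}, G(a_i, …, a_{i+p-1}), a_{i+p}, …, a_{N-1})`. -/
def insertArgs {m p N : ℕ} (h : N + 1 = m + p) (G : MultilinearMap K (fun _ : Fin p => D) D)
    (i : Fin m) (a : Fin N → D) (k : Fin m) : D :=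
  if _ : k < i then a ⟨k, by omega⟩
  else if _ : k = i then G (fun l => a ⟨i + l, by omega⟩)
  else a ⟨k + p - 1, by omega⟩

theorem insertArgs_update {m p N : ℕ} (h : N + 1 = m + p)
    (G : MultilinearMap K (fun _ : Fin p => D) D) (i : Fin m) (j : Fin N) :
    (∃ k : Fin m, ∀ (a : Fin N → D) (x : D), insertArgs h G i (Function.update a j x)
      = Function.update (insertArgs h G i a) k x) ∨
    (∃ l : Fin p, ∀ (a : Fin N → D) (x : D), insertArgs h G i (Function.update a j x)
      = Function.update (insertArgs h G i a) i
        (G (Function.update (fun l : Fin p => a ⟨i + l, by omega⟩) l x))) := by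
  by_cases h1 : (j : ℕ) < i
  · refine Or.inl ⟨⟨j, by omega⟩, fun a x => funext fun k => ?_⟩
    simp only [insertArgs, Function.update_apply, Fin.lt_def, Fin.ext_iff]
    split_ifs <;> first | rfl | omega | skip
    congr 1
    funext l
    rw [if_neg (by omega)]
  · by_cases h2 : (j : ℕ) < i + p
    · refine Or.inr ⟨⟨j - i, by omega⟩, fun a x => funext fun k => ?_⟩
      simp only [insertArgs, Function.update_apply, Fin.lt_def, Fin.ext_iff]
      split_ifs <;> first | rfl | omega | skip
      congr 1
      funext l
      simp only [Function.update_apply, Fin.ext_iff]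
      split_ifs <;> first | rfl | omega
    · refine Or.inl ⟨⟨j + 1 - p, by omega⟩, fun a x => funext fun k => ?_⟩
      simp only [insertArgs, Function.update_apply, Fin.lt_def, Fin.ext_iff]
      split_ifs <;> first | rfl | omega | skip
      congr 1
      funext l
      rw [if_neg (by omega)]

/-- `a ↦ F(a_0, …, a_{i-1}, G(a_i, …, a_{i+p-1}), a_{i+p}, …, a_{N-1})`. -/
def insertAt {m p N : ℕ} (h : N + 1 = m + p) (F : MultilinearMap K (fun _ : Fin m => D) M)
    (i : Fin m) (G : MultilinearMap K (fun _ : Fin p => D) D) :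
    MultilinearMap K (fun _ : Fin N => D) M where
  toFun a := F (insertArgs h G i a)
  map_update_add' := by
    intro inst a j x y
    rw [Subsingleton.elim inst (instDecidableEqFin N)]
    obtain ⟨k, hk⟩ | ⟨l, hl⟩ := insertArgs_update h G i j
    · simp only [hk, MultilinearMap.map_update_add]
    · simp only [hl, MultilinearMap.map_update_add]
  map_update_smul' := by
    intro inst a j c x
    rw [Subsingleton.elim inst (instDecidableEqFin N)]
    obtain ⟨k, hk⟩ | ⟨l, hl⟩ := insertArgs_update h G i j
    · simp only [hk, MultilinearMap.map_update_smul]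
    · simp only [hl, MultilinearMap.map_update_smul]

/-- `a ↦ L(a_0, f(a_1, …, a_n))`. -/
def actLeft {n : ℕ} (L : D →ₗ[K] M →ₗ[K] M) (f : MultilinearMap K (fun _ : Fin n => D) M) :
    MultilinearMap K (fun _ : Fin (n + 1) => D) M where
  toFun a := L (a 0) (f (fun k => a k.succ))
  map_update_add' := by
    intro inst a j x y
    rw [Subsingleton.elim inst (instDecidableEqFin (n + 1))]
    induction j using Fin.cases with
    | zero => simp
    | succ j => simp [update_succ_comp, (Fin.succ_ne_zero j).symm]
  map_update_smul' := by
    intro inst a j c x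
    rw [Subsingleton.elim inst (instDecidableEqFin (n + 1))]
    induction j using Fin.cases with
    | zero => simp
    | succ j => simp [update_succ_comp, (Fin.succ_ne_zero j).symm]

/-- `a ↦ R(f(a_0, …, a_{n-1}), a_n)`. -/
def actRight {n : ℕ} (R : M →ₗ[K] D →ₗ[K] M) (f : MultilinearMap K (fun _ : Fin n => D) M) :
    MultilinearMap K (fun _ : Fin (n + 1) => D) M where
  toFun a := R (f (fun k => a k.castSucc)) (a (Fin.last n))
  map_update_add' := by
    intro inst a j x y
    rw [Subsingleton.elim inst (instDecidableEqFin (n + 1))]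
    induction j using Fin.lastCases with
    | last => simp [(Fin.castSucc_lt_last _).ne]
    | cast j => simp [update_castSucc_comp, (Fin.castSucc_lt_last j).ne']
  map_update_smul' := by
    intro inst a j c x
    rw [Subsingleton.elim inst (instDecidableEqFin (n + 1))]
    induction j using Fin.lastCases with
    | last => simp [(Fin.castSucc_lt_last _).ne]
    | cast j => simp [update_castSucc_comp, (Fin.castSucc_lt_last j).ne']

end

/-! ### Cochains -/

/-- The module of `n`-cochains `CY^n(D, M) = Hom(K[Y_n] ⊗ D^{⊗ n}, M)`: a family, indexed by
`n`-trees, of `n`-linear maps `D × ⋯ × D → M`. -/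
abbrev CY (K : Type*) (n : ℕ) (D M : Type*) [Field K] [AddCommGroup D] [Module K D]
    [AddCommGroup M] [Module K M] :=
  Y n → MultilinearMap K (fun _ : Fin n => D) M

section

variable {K D E M : Type*} [Field K] [AddCommGroup D] [Module K D] [AddCommGroup E] [Module K E]
  [AddCommGroup M] [Module K M]

/-- The coboundary `δ = ∑_{i=0}^{n+1} (-1)^i δ^i : CY^n(D, M) → CY^{n+1}(D, M)`. The inner faces
`δ^{i+1}`, `0 ≤ i < n`, multiply the arguments `a_{i+1}` and `a_{i+2}` (numbered from `1`). -/
def coboundary [Dialgebra K D] (ρ : Rep K D M) {n : ℕ} (f : CY K n D M) : CY K (n + 1) D M :=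
  fun y =>
    actLeft (ρ.lact (opFirst y.1)) (f (y.d 0))
    + ∑ i : Fin n, (-1 : K) ^ ((i : ℕ) + 1) •
        insertAt (by omega) (f (y.d i.succ.castSucc)) i
          (bilin (Dialgebra.mul (K := K) (opInner y.1 (i + 1))))
    + (-1 : K) ^ (n + 1) • actRight (ρ.ract (opLast y.1)) (f (y.d (Fin.last (n + 1))))

/-- The pre-Lie product `CY^{m+1}(D, D) × CY^{n+1}(D, D) → CY^{m+n+1}(D, D)`,
`f ∘ g = ∑_{i=0}^{m} (-1)^{n i} f ∘_i g`, where `f ∘_i g` inserts `g` in slot `i` of `f`. -/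
def preLie {m n : ℕ} (f : CY K (m + 1) D D) (g : CY K (n + 1) D D) : CY K (m + n + 1) D D :=
  fun y => ∑ i : Fin (m + 1), (-1 : K) ^ (n * (i : ℕ)) •
    insertAt (by omega) (f (y.outer i)) i (g (y.inner i))

/-- The `2`-cochain determined by a pair of bilinear maps `(F^l; F^r)`. -/
def cochainOfPair (F : Side → D →ₗ[K] D →ₗ[K] M) : CY K 2 D M :=
  fun y => bilin (F (treeSide y))

/-- The push-forward `ψ ξ`. -/
def pushLeft (ψ : D →ₗ[K] E) {n : ℕ} (ξ : CY K n D D) : CY K n D E :=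
  fun y => ψ.compMultilinearMap (ξ y)

/-- The push-forward `π ψ`. -/
def pushRight (ψ : D →ₗ[K] E) {n : ℕ} (π : CY K n E E) : CY K n D E :=
  fun y => (π y).compLinearMap (fun _ => ψ)

end

/-! ### The deformation complex of a morphism -/

/-- `CY^{n-1}(D, M)`, where `CY^{-1}(D, M)` is zero. -/
def CYPred (K : Type u) (n : ℕ) (D : Type v) (M : Type w) [Field K] [AddCommGroup D] [Module K D]
    [AddCommGroup M] [Module K M] : Type (max v w) :=
  match n with
  | 0 => PUnit.{max v w + 1}
  | n + 1 => CY K n D M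

section

variable {K : Type u} {D : Type v} {E : Type w} [Field K]
  [AddCommGroup D] [Module K D] [AddCommGroup E] [Module K E]

noncomputable instance (n : ℕ) : AddCommGroup (CYPred K n D E) :=
  match n with
  | 0 => (inferInstance : AddCommGroup PUnit.{max v w + 1})
  | n + 1 => (inferInstance : AddCommGroup (CY K n D E))

noncomputable instance (n : ℕ) : Module K (CYPred K n D E) :=
  match n with
  | 0 => (inferInstance : Module K PUnit.{max v w + 1})
  | n + 1 => (inferInstance : Module K (CY K n D E))

end

section

variable {K D E : Type*} [Field K] [AddCommGroup D] [Module K D] [Dialgebra K D]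
  [AddCommGroup E] [Module K E] [Dialgebra K E]

/-- The coboundary `CY^{n-1}(D, E) → CY^n(D, E)`. -/
def coboundaryPred (ψ : DialgebraHom K D E) :
    (n : ℕ) → CYPred K n D E → CY K n D E
  | 0, _ => 0
  | _ + 1, φ => coboundary ψ.rep φ

/-- `CY^n(ψ, ψ) = CY^n(D, D) × CY^n(E, E) × CY^{n-1}(D, E)`. -/
abbrev CYMor (_ψ : DialgebraHom K D E) (n : ℕ) :=
  CY K n D D × CY K n E E × CYPred K n D E

/-- `δ(ξ; π; φ) = (δ ξ; δ π; ψ ξ - π ψ - δ φ)`. -/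
def coboundaryMor (ψ : DialgebraHom K D E) (n : ℕ) (θ : CYMor ψ n) : CYMor ψ (n + 1) :=
  (coboundary (Rep.self K D) θ.1, coboundary (Rep.self K E) θ.2.1,
    (pushLeft ψ.toLin θ.1 - pushRight ψ.toLin θ.2.1 - coboundaryPred ψ n θ.2.2 : CY K n D E))

/-- An `n`-cocycle of the deformation complex of `ψ`. -/
def IsCocycle (ψ : DialgebraHom K D E) {n : ℕ} (θ : CYMor ψ n) : Prop :=
  coboundaryMor ψ n θ = 0

end

/-! ### Deformations of finite order -/

/-- A deformation of order `N` of the dialgebra `D`: `f_t = ∑_{i=0}^N (F_i^l; F_i^r) t^i`, with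
`F_0` the given products, satisfying the dialgebra axioms modulo `t^{N+1}`. -/
structure DialgebraDeformation (K D : Type*) [Field K] [AddCommGroup D] [Module K D]
    [Dialgebra K D] (N : ℕ) where
  F : ℕ → Side → D →ₗ[K] D →ₗ[K] D
  F_zero : F 0 = Dialgebra.mul
  F_eq_zero : ∀ i, N < i → F i = 0
  axiom₁ : ∀ ν ≤ N, ∀ x y z : D,
    ∑ p ∈ Finset.HasAntidiagonal.antidiagonal ν, F p.1 .left x (F p.2 .left y z)
      = ∑ p ∈ Finset.HasAntidiagonal.antidiagonal ν, F p.1 .left (F p.2 .left x y) z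
  axiom₂ : ∀ ν ≤ N, ∀ x y z : D,
    ∑ p ∈ Finset.HasAntidiagonal.antidiagonal ν, F p.1 .left (F p.2 .left x y) z
      = ∑ p ∈ Finset.HasAntidiagonal.antidiagonal ν, F p.1 .left x (F p.2 .right y z)
  axiom₃ : ∀ ν ≤ N, ∀ x y z : D,
    ∑ p ∈ Finset.HasAntidiagonal.antidiagonal ν, F p.1 .left (F p.2 .right x y) z
      = ∑ p ∈ Finset.HasAntidiagonal.antidiagonal ν, F p.1 .right x (F p.2 .left y z)
  axiom₄ : ∀ ν ≤ N, ∀ x y z : D,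
    ∑ p ∈ Finset.HasAntidiagonal.antidiagonal ν, F p.1 .right (F p.2 .left x y) z
      = ∑ p ∈ Finset.HasAntidiagonal.antidiagonal ν, F p.1 .right x (F p.2 .right y z)
  axiom₅ : ∀ ν ≤ N, ∀ x y z : D,
    ∑ p ∈ Finset.HasAntidiagonal.antidiagonal ν, F p.1 .right x (F p.2 .right y z)
      = ∑ p ∈ Finset.HasAntidiagonal.antidiagonal ν, F p.1 .right (F p.2 .right x y) z

/-- The triples `(i, j, k)` of natural numbers with `i + j + k = n`. -/
def triples (n : ℕ) : Finset (ℕ × ℕ × ℕ) :=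
  (Finset.range (n + 1) ×ˢ Finset.range (n + 1) ×ˢ Finset.range (n + 1)).filter
    (fun p => p.1 + p.2.1 + p.2.2 = n)

/-- The index set of the primed sum of the obstruction: the triples `(i, j, k)` with
`i + j + k = N + 1` such that exactly one of `i, j, k` is zero or all are positive. -/
def primedTriples (N : ℕ) : Finset (ℕ × ℕ × ℕ) :=
  (triples (N + 1)).filter (fun p =>
    (0 < p.1 ∧ 0 < p.2.1 ∧ p.2.2 = 0) ∨ (0 < p.1 ∧ p.2.1 = 0 ∧ 0 < p.2.2) ∨
    (p.1 = 0 ∧ 0 < p.2.1 ∧ 0 < p.2.2) ∨ (0 < p.1 ∧ 0 < p.2.1 ∧ 0 < p.2.2))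

section

variable {K D E : Type*} [Field K] [AddCommGroup D] [Module K D] [Dialgebra K D]
  [AddCommGroup E] [Module K E] [Dialgebra K E]

/-- A deformation of order `N` of `ψ`: a triple `(f_{D,t}; f_{E,t}; Ψ_t)` with
`Ψ_t = ∑_{i=0}^N ψ_i t^i`, `ψ_0 = ψ`, which respects the deformed products modulo `t^{N+1}`. -/
structure MorDeformation (ψ : DialgebraHom K D E) (N : ℕ) where
  defD : DialgebraDeformation K D N
  defE : DialgebraDeformation K E N
  psi : ℕ → D →ₗ[K] E
  psi_zero : psi 0 = ψ.toLin
  psi_eq_zero : ∀ i, N < i → psi i = 0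
  map_mul : ∀ n ≤ N, ∀ (s : Side) (a b : D),
    ∑ p ∈ Finset.HasAntidiagonal.antidiagonal n, psi p.1 (defD.F p.2 s a b)
      = ∑ p ∈ triples n, defE.F p.1 s (psi p.2.1 a) (psi p.2.2 b)

/-- `∑_{i + j = N + 1, i, j > 0} F_i ∘ F_j`, for the pre-Lie product `∘`. -/
def DialgebraDeformation.ob {N : ℕ} (f : DialgebraDeformation K D N) : CY K 3 D D :=
  ∑ p ∈ (Finset.HasAntidiagonal.antidiagonal (N + 1)).filter (fun p => 0 < p.1 ∧ 0 < p.2),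
    preLie (m := 1) (n := 1) (cochainOfPair (f.F p.1)) (cochainOfPair (f.F p.2))

/-- The last component of the obstruction:
`∑' F^*_{E,i}(ψ_j a, ψ_k b) - ∑_{i=1}^N ψ_i F^*_{D,N+1-i}(a, b)`. -/
def MorDeformation.obPsi {ψ : DialgebraHom K D E} {N : ℕ} (Θ : MorDeformation ψ N) :
    CY K 2 D E :=
  cochainOfPair fun s =>
    ∑ p ∈ primedTriples N, (Θ.defE.F p.1 s).compl₁₂ (Θ.psi p.2.1) (Θ.psi p.2.2)
    - ∑ i ∈ Finset.Icc 1 N, (Θ.defD.F (N + 1 - i) s).compr₂ (Θ.psi i)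

/-- The obstruction class `Ob(Θ_t) = (Ob_D; Ob_E; Ob_ψ) ∈ CY^3(ψ, ψ)`. -/
def MorDeformation.ob {ψ : DialgebraHom K D E} {N : ℕ} (Θ : MorDeformation ψ N) : CYMor ψ 3 :=
  (Θ.defD.ob, Θ.defE.ob, Θ.obPsi)

end

end YauDialg

/-! Work with series `ℕ → D`, that is, with $D[[t]]$. Extended $t$-bilinearly, the truncated
deformation gives honest products $m_s$ on series, not assumed associative in any sense. Each tree
with three nodes defines an associator of these products, with sides read off from its four faces.
Two identities hold for arbitrary bilinear products and linear maps. `associator_pentagon` says that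
an alternating sum of associators over the faces of a four-node tree is zero. `homDefect_square`
says that the coboundary-like sum of the defect $m'(\varphi x,\varphi y)-\varphi(m(x,y))$ is the
difference of the two associators. A deformation of order $N$ makes associators and defects of
constants vanish through degree $N$. By $t$-linearity, their coefficient in degree $N+1$ then
depends only on the constant terms of the arguments, and any product or map applied to them acts in
that degree through its undeformed part (`AssocUpTo.succ`, `seriesMul_succ_of_left`,
`seriesMul_succ_of_right`). These leading coefficients are the obstruction cochains
(`DialgebraDeformation.ob_apply`, `MorDeformation.obPsi_apply`). Reading the two identities in
degree $N+1$ therefore gives $\delta\mathrm{Ob}_D=0$, $\delta\mathrm{Ob}_E=0$ and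
$\delta\mathrm{Ob}_\psi=\psi\mathrm{Ob}_D-\mathrm{Ob}_E\psi$, which are the three components of the
cocycle condition. -/

namespace YauDialg

/-! ### Formal power series with coefficients in a module -/

section Series

variable {K P Q R : Type*} [Field K] [AddCommGroup P] [Module K P] [AddCommGroup Q] [Module K Q]
  [AddCommGroup R] [Module K R]

/-- A series of linear maps acting on series by convolution. -/
def seriesApply : (ℕ → P →ₗ[K] Q) →ₗ[K] (ℕ → P) →ₗ[K] (ℕ → Q) :=
  LinearMap.mk₂ K
    (fun L x n => ∑ p ∈ Finset.HasAntidiagonal.antidiagonal n, L p.1 (x p.2))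
    (fun L L' x => by funext n; simp [Finset.sum_add_distrib])
    (fun c L x => by funext n; simp [Finset.smul_sum])
    (fun L x x' => by funext n; simp [Finset.sum_add_distrib])
    (fun c L x => by funext n; simp [Finset.smul_sum])

theorem seriesApply_apply (L : ℕ → P →ₗ[K] Q) (x : ℕ → P) (n : ℕ) :
    seriesApply L x n = ∑ p ∈ Finset.HasAntidiagonal.antidiagonal n, L p.1 (x p.2) := rfl

/-- A series of bilinear maps acting on pairs of series by convolution. -/
def seriesMul (B : ℕ → P →ₗ[K] Q →ₗ[K] R) : (ℕ → P) →ₗ[K] (ℕ → Q) →ₗ[K] (ℕ → R) :=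
  seriesApply.comp (seriesApply B)

theorem seriesMul_apply (B : ℕ → P →ₗ[K] Q →ₗ[K] R) (x : ℕ → P) (y : ℕ → Q) :
    seriesMul B x y = seriesApply (seriesApply B x) y := rfl

/-- Multiplication of a series by the formal parameter. -/
def shift (x : ℕ → P) : ℕ → P
  | 0 => 0
  | n + 1 => x n

theorem shift_sub (x y : ℕ → P) : shift (x - y) = shift x - shift y := by
  funext n; cases n <;> simp [shift]

theorem eq_single_add_shift (x : ℕ → P) :
    x = Pi.single 0 (x 0) + shift (fun n => x (n + 1)) := by
  funext n; cases n <;> simp [shift]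

theorem seriesApply_shift_left (L : ℕ → P →ₗ[K] Q) (x : ℕ → P) :
    seriesApply (shift L) x = shift (seriesApply L x) := by
  funext n
  cases n with
  | zero => simp [seriesApply_apply, shift]
  | succ n => simp [seriesApply_apply, shift, Finset.Nat.antidiagonal_succ]

theorem seriesApply_shift_right (L : ℕ → P →ₗ[K] Q) (x : ℕ → P) :
    seriesApply L (shift x) = shift (seriesApply L x) := by
  funext n
  cases n with
  | zero => simp [seriesApply_apply, shift]
  | succ n => simp [seriesApply_apply, shift, Finset.Nat.antidiagonal_succ']

theorem seriesMul_shift_left (B : ℕ → P →ₗ[K] Q →ₗ[K] R) (x : ℕ → P) (y : ℕ → Q) :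
    seriesMul B (shift x) y = shift (seriesMul B x y) := by
  simp only [seriesMul_apply, seriesApply_shift_left, seriesApply_shift_right]

theorem seriesMul_shift_right (B : ℕ → P →ₗ[K] Q →ₗ[K] R) (x : ℕ → P) (y : ℕ → Q) :
    seriesMul B x (shift y) = shift (seriesMul B x y) := by
  simp only [seriesMul_apply, seriesApply_shift_right]

theorem seriesApply_single (L : ℕ → P →ₗ[K] Q) (a : P) :
    seriesApply L (Pi.single 0 a) = fun n => L n a := by
  funext n
  rw [seriesApply_apply, Finset.sum_eq_single (n, 0)]
  · simp
  · rintro ⟨i, j⟩ hp hne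
    have hj : j ≠ 0 := by
      rintro rfl
      simp only [Finset.HasAntidiagonal.mem_antidiagonal, add_zero] at hp
      exact hne (by rw [hp])
    simp [hj]
  · simp

theorem seriesMul_single_left (B : ℕ → P →ₗ[K] Q →ₗ[K] R) (a : P) (y : ℕ → Q) (n : ℕ) :
    seriesMul B (Pi.single 0 a) y n
      = ∑ p ∈ Finset.HasAntidiagonal.antidiagonal n, B p.1 a (y p.2) := by
  rw [seriesMul_apply, seriesApply_single, seriesApply_apply]

theorem seriesMul_single_right (B : ℕ → P →ₗ[K] Q →ₗ[K] R) (x : ℕ → P) (b : Q) (n : ℕ) :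
    seriesMul B x (Pi.single 0 b) n
      = ∑ p ∈ Finset.HasAntidiagonal.antidiagonal n, B p.1 (x p.2) b := by
  rw [seriesMul_apply, seriesApply_single]
  simp only [seriesApply_apply, LinearMap.sum_apply]

theorem seriesMul_single_single (B : ℕ → P →ₗ[K] Q →ₗ[K] R) (a : P) (b : Q) :
    seriesMul B (Pi.single 0 a) (Pi.single 0 b) = fun n => B n a b := by
  rw [seriesMul_apply, seriesApply_single, seriesApply_single]

/-- A series whose coefficients below degree `N + 1` vanish sees only the constant term of `L`. -/
theorem seriesApply_succ_of_right (L : ℕ → P →ₗ[K] Q) (x : ℕ → P) (N : ℕ)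
    (h : ∀ n ≤ N, x n = 0) : seriesApply L x (N + 1) = L 0 (x (N + 1)) := by
  rw [seriesApply_apply, Finset.sum_eq_single (0, N + 1)]
  · rintro ⟨i, j⟩ hp hne
    simp only [Finset.HasAntidiagonal.mem_antidiagonal] at hp
    have hj : j ≤ N := by
      by_contra hj
      exact hne (Prod.ext (by simp only; omega) (by simp only; omega))
    simp [h j hj]
  · simp

theorem seriesApply_succ_of_left (L : ℕ → P →ₗ[K] Q) (x : ℕ → P) (N : ℕ)
    (h : ∀ n ≤ N, L n = 0) : seriesApply L x (N + 1) = L (N + 1) (x 0) := by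
  rw [seriesApply_apply, Finset.sum_eq_single (N + 1, 0)]
  · rintro ⟨i, j⟩ hp hne
    simp only [Finset.HasAntidiagonal.mem_antidiagonal] at hp
    have hi : i ≤ N := by
      by_contra hi
      exact hne (Prod.ext (by simp only; omega) (by simp only; omega))
    simp [h i hi]
  · simp

theorem seriesApply_eq_zero_of_right (L : ℕ → P →ₗ[K] Q) (x : ℕ → P) (N : ℕ)
    (h : ∀ n ≤ N, x n = 0) (n : ℕ) (hn : n ≤ N) : seriesApply L x n = 0 := by
  rw [seriesApply_apply]
  refine Finset.sum_eq_zero fun p hp => ?_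
  rw [Finset.HasAntidiagonal.mem_antidiagonal] at hp
  rw [h p.2 (by omega), map_zero]

theorem seriesApply_zero (L : ℕ → P →ₗ[K] Q) (x : ℕ → P) : seriesApply L x 0 = L 0 (x 0) := by
  simp [seriesApply_apply]

theorem seriesMul_succ_of_right (B : ℕ → P →ₗ[K] Q →ₗ[K] R) (x : ℕ → P) (y : ℕ → Q) (N : ℕ)
    (h : ∀ n ≤ N, y n = 0) : seriesMul B x y (N + 1) = B 0 (x 0) (y (N + 1)) := by
  rw [seriesMul_apply, seriesApply_succ_of_right _ _ _ h, seriesApply_zero]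

theorem seriesMul_succ_of_left (B : ℕ → P →ₗ[K] Q →ₗ[K] R) (x : ℕ → P) (y : ℕ → Q) (N : ℕ)
    (h : ∀ n ≤ N, x n = 0) : seriesMul B x y (N + 1) = B 0 (x (N + 1)) (y 0) := by
  -- The series of maps `seriesApply B x` inherits from `x` its vanishing through degree `N`, so
  -- only its coefficient in degree `N + 1` meets `y 0`.
  rw [seriesMul_apply,
    seriesApply_succ_of_left _ _ _ (seriesApply_eq_zero_of_right B x N h),
    seriesApply_succ_of_right _ _ _ h]

/-- An additive map of series commuting with the parameter vanishes in degrees `≤ N` as soon as it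
does so on constants. -/
theorem coeff_eq_zero_of_single (L : (ℕ → P) → (ℕ → Q)) (hadd : ∀ x y, L (x + y) = L x + L y)
    (hshift : ∀ x, L (shift x) = shift (L x)) (N : ℕ)
    (h : ∀ a, ∀ n ≤ N, L (Pi.single 0 a) n = 0) (x : ℕ → P) (n : ℕ) (hn : n ≤ N) :
    L x n = 0 := by
  induction n generalizing x with
  | zero => rw [eq_single_add_shift x, hadd, hshift]; simp [h _ 0 hn, shift]
  | succ n ih =>
    rw [eq_single_add_shift x, hadd, hshift]; simp [h _ _ hn, shift, ih _ (by omega)]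

/-- Split off the constant term of `x`. The rest is $t$ times a series, so it contributes a
coefficient of degree `N`, which vanishes by the previous lemma. -/
theorem coeff_succ_eq_single (L : (ℕ → P) → (ℕ → Q)) (hadd : ∀ x y, L (x + y) = L x + L y)
    (hshift : ∀ x, L (shift x) = shift (L x)) (N : ℕ)
    (h : ∀ a, ∀ n ≤ N, L (Pi.single 0 a) n = 0) (x : ℕ → P) :
    L x (N + 1) = L (Pi.single 0 (x 0)) (N + 1) := by
  conv_lhs => rw [eq_single_add_shift x, hadd, hshift]
  simp [shift, coeff_eq_zero_of_single L hadd hshift N h]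

end Series

/-! ### Sides of trees -/

/-- The product attached to a tree with two nodes. -/
def sideOf (t : BinaryTree Unit) : Side :=
  if t = .node () .nil (.node () .nil .nil) then .left else .right

/-- All planar binary trees of depth at most `h`. -/
def treesOfDepth : ℕ → List (BinaryTree Unit)
  | 0 => [.nil]
  | h + 1 => .nil :: (treesOfDepth h).flatMap fun l => (treesOfDepth h).map (.node () l)

/-- The depth of a tree is at most its number of nodes. Statements about all trees with a given
number of nodes thus become finite checks. -/
theorem mem_treesOfDepth (t : BinaryTree Unit) (h : ℕ) (ht : t.numNodes ≤ h) :
    t ∈ treesOfDepth h := by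
  induction h generalizing t with
  | zero => cases t with
    | nil => simp [treesOfDepth]
    | node u l r => simp at ht
  | succ h ih => cases t with
    | nil => simp [treesOfDepth]
    | node u l r =>
      simp only [BinaryTree.numNodes] at ht
      have hl := ih l (by omega)
      have hr := ih r (by omega)
      simp [treesOfDepth, hl, hr]

/-- Identifies the operations in the coboundary of a 2-cochain with the sides used by the associator
of the same tree. -/
theorem sides_of_numNodes_three (t : BinaryTree Unit) (ht : t.numNodes = 3) :
    opFirst t = sideOf (deleteLeaf t 2) ∧ opInner t 1 = sideOf (deleteLeaf t 3) ∧
    opInner t 2 = sideOf (deleteLeaf t 0) ∧ opLast t = sideOf (deleteLeaf t 1) := by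
  have key : ∀ t ∈ treesOfDepth 3, t.numNodes = 3 →
      opFirst t = sideOf (deleteLeaf t 2) ∧ opInner t 1 = sideOf (deleteLeaf t 3) ∧
      opInner t 2 = sideOf (deleteLeaf t 0) ∧ opLast t = sideOf (deleteLeaf t 1) := by
    decide
  exact key t (mem_treesOfDepth t 3 ht.le) ht

/-- The sides attached to a tree with three nodes: the outer and the inner side of the bracketing
`(x y) z`, then those of `x (y z)`, one tuple for each of the five axioms. -/
theorem axiomSides (t : BinaryTree Unit) (ht : t.numNodes = 3) :
    (sideOf (deleteLeaf t 1), sideOf (deleteLeaf t 3), sideOf (deleteLeaf t 2),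
      sideOf (deleteLeaf t 0)) ∈
    ([(.left, .left, .left, .left), (.left, .left, .left, .right), (.left, .right, .right, .left),
      (.right, .left, .right, .right), (.right, .right, .right, .right)] :
        List (Side × Side × Side × Side)) := by
  have key : ∀ t ∈ treesOfDepth 3, t.numNodes = 3 →
    (sideOf (deleteLeaf t 1), sideOf (deleteLeaf t 3), sideOf (deleteLeaf t 2),
      sideOf (deleteLeaf t 0)) ∈
    ([(.left, .left, .left, .left), (.left, .left, .left, .right), (.left, .right, .right, .left),
      (.right, .left, .right, .right), (.right, .right, .right, .right)] :
        List (Side × Side × Side × Side)) := by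
    decide
  exact key t (mem_treesOfDepth t 3 ht.le) ht

/-- The compatibilities between the sides in the five bracketings `x ((y z) w)`, `x (y (z w))`,
`((x y) z) w`, `(x y) (z w)`, `(x (y z)) w`. -/
theorem sides_of_numNodes_four (t : BinaryTree Unit) (ht : t.numNodes = 4) :
    let s (i j : ℕ) : Side := sideOf (deleteLeaf (deleteLeaf t i) j)
    (s 2 2 = opFirst t ∧ s 2 0 = s 0 1 ∧ s 0 3 = opInner t 2) ∧
    (s 3 2 = opFirst t ∧ s 3 0 = s 0 2 ∧ s 0 0 = opInner t 3) ∧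
    (s 1 1 = opLast t ∧ s 4 1 = s 1 3 ∧ s 4 3 = opInner t 1) ∧
    (s 3 1 = s 1 2 ∧ s 3 3 = opInner t 1 ∧ s 1 0 = opInner t 3) ∧
    (s 2 1 = opLast t ∧ s 4 2 = s 2 3 ∧ s 4 0 = opInner t 2) := by
  have key : ∀ t ∈ treesOfDepth 4, t.numNodes = 4 →
    let s (i j : ℕ) : Side := sideOf (deleteLeaf (deleteLeaf t i) j)
    (s 2 2 = opFirst t ∧ s 2 0 = s 0 1 ∧ s 0 3 = opInner t 2) ∧
    (s 3 2 = opFirst t ∧ s 3 0 = s 0 2 ∧ s 0 0 = opInner t 3) ∧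
    (s 1 1 = opLast t ∧ s 4 1 = s 1 3 ∧ s 4 3 = opInner t 1) ∧
    (s 3 1 = s 1 2 ∧ s 3 3 = opInner t 1 ∧ s 1 0 = opInner t 3) ∧
    (s 2 1 = opLast t ∧ s 4 2 = s 2 3 ∧ s 4 0 = opInner t 2) := by
    -- The list has 677 trees, of which only the fourteen with four nodes give a nonvacuous check.
    decide +kernel
  exact key t (mem_treesOfDepth t 4 ht.le) ht

/-! ### Associators -/

section Associator

variable {K S T : Type*} [Field K] [AddCommGroup S] [Module K S] [AddCommGroup T] [Module K T]

/-- The associator attached to a tree with three nodes. -/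
def associator (m : Side → S →ₗ[K] S →ₗ[K] S) (t : BinaryTree Unit) (x y z : S) : S :=
  m (sideOf (deleteLeaf t 1)) (m (sideOf (deleteLeaf t 3)) x y) z
    - m (sideOf (deleteLeaf t 2)) x (m (sideOf (deleteLeaf t 0)) y z)

/-- Expanding the five associators gives ten terms. Each of the five bracketings of `a b c d` occurs
twice with opposite signs, and the face relations make the sides of the two copies agree. -/
theorem associator_pentagon (m : Side → S →ₗ[K] S →ₗ[K] S) (t : BinaryTree Unit)
    (ht : t.numNodes = 4) (a b c d : S) :
    m (opFirst t) a (associator m (deleteLeaf t 0) b c d)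
      - associator m (deleteLeaf t 1) (m (opInner t 1) a b) c d
      + associator m (deleteLeaf t 2) a (m (opInner t 2) b c) d
      - associator m (deleteLeaf t 3) a b (m (opInner t 3) c d)
      + m (opLast t) (associator m (deleteLeaf t 4) a b c) d = 0 := by
  obtain ⟨⟨h1, h2, h3⟩, ⟨h4, h5, h6⟩, ⟨h7, h8, h9⟩, ⟨h10, h11, h12⟩, ⟨h13, h14, h15⟩⟩ :=
    sides_of_numNodes_four t ht
  simp only [associator, h1, h2, h3, h4, h5, h6, h7, h8, h9, h10, h11, h12, h13, h14, h15,
    map_sub, LinearMap.sub_apply]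
  abel

/-- The failure of `φ` to respect the products. -/
def homDefect (m : Side → S →ₗ[K] S →ₗ[K] S) (m' : Side → T →ₗ[K] T →ₗ[K] T) (φ : S →ₗ[K] T)
    (s : Side) (x y : S) : T :=
  m' s (φ x) (φ y) - φ (m s x y)

/-- The mixed terms, a product of `φ` of one argument with `φ` of a product, cancel in pairs. What
remains are the bracketings formed wholly before or wholly after applying `φ`. -/
theorem homDefect_square (m : Side → S →ₗ[K] S →ₗ[K] S) (m' : Side → T →ₗ[K] T →ₗ[K] T)
    (φ : S →ₗ[K] T) (t : BinaryTree Unit) (ht : t.numNodes = 3) (a b c : S) :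
    m' (opFirst t) (φ a) (homDefect m m' φ (sideOf (deleteLeaf t 0)) b c)
      - homDefect m m' φ (sideOf (deleteLeaf t 1)) (m (opInner t 1) a b) c
      + homDefect m m' φ (sideOf (deleteLeaf t 2)) a (m (opInner t 2) b c)
      - m' (opLast t) (homDefect m m' φ (sideOf (deleteLeaf t 3)) a b) (φ c)
      = φ (associator m t a b c) - associator m' t (φ a) (φ b) (φ c) := by
  obtain ⟨h1, h2, h3, h4⟩ := sides_of_numNodes_three t ht
  simp only [associator, homDefect, h1, h2, h3, h4, map_sub, LinearMap.sub_apply]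
  abel

end Associator

/-! ### Leading coefficients of associators and defects of series -/

section SeriesAssociator

variable {K D E : Type*} [Field K] [AddCommGroup D] [Module K D] [AddCommGroup E] [Module K E]
  (B : Side → ℕ → D →ₗ[K] D →ₗ[K] D) (B' : Side → ℕ → E →ₗ[K] E →ₗ[K] E) (L : ℕ → D →ₗ[K] E)

/-- The product of series for each side. -/
def seriesProd (s : Side) : (ℕ → D) →ₗ[K] (ℕ → D) →ₗ[K] (ℕ → D) := seriesMul (B s)

theorem associator_seriesProd_single (t : BinaryTree Unit) (a b c : D) (n : ℕ) :
    associator (seriesProd B) t (Pi.single 0 a) (Pi.single 0 b) (Pi.single 0 c) n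
      = ∑ p ∈ Finset.HasAntidiagonal.antidiagonal n,
          (B (sideOf (deleteLeaf t 1)) p.1 (B (sideOf (deleteLeaf t 3)) p.2 a b) c
            - B (sideOf (deleteLeaf t 2)) p.1 a (B (sideOf (deleteLeaf t 0)) p.2 b c)) := by
  rw [associator, Pi.sub_apply, seriesProd, seriesProd, seriesProd, seriesProd,
    seriesMul_single_right, seriesMul_single_left, seriesMul_single_single,
    seriesMul_single_single, Finset.sum_sub_distrib]

variable {B}

theorem associator_add_left (t : BinaryTree Unit) (x x' y z : ℕ → D) :
    associator (seriesProd B) t (x + x') y z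
      = associator (seriesProd B) t x y z + associator (seriesProd B) t x' y z := by
  simp only [associator, map_add, LinearMap.add_apply]; abel

theorem associator_add_middle (t : BinaryTree Unit) (x y y' z : ℕ → D) :
    associator (seriesProd B) t x (y + y') z
      = associator (seriesProd B) t x y z + associator (seriesProd B) t x y' z := by
  simp only [associator, map_add, LinearMap.add_apply]; abel

theorem associator_add_right (t : BinaryTree Unit) (x y z z' : ℕ → D) :
    associator (seriesProd B) t x y (z + z')
      = associator (seriesProd B) t x y z + associator (seriesProd B) t x y z' := by
  simp only [associator, map_add]; abel

theorem associator_shift_left (t : BinaryTree Unit) (x y z : ℕ → D) :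
    associator (seriesProd B) t (shift x) y z = shift (associator (seriesProd B) t x y z) := by
  simp only [associator, seriesProd, seriesMul_shift_left, shift_sub]

theorem associator_shift_middle (t : BinaryTree Unit) (x y z : ℕ → D) :
    associator (seriesProd B) t x (shift y) z = shift (associator (seriesProd B) t x y z) := by
  simp only [associator, seriesProd, seriesMul_shift_left, seriesMul_shift_right, shift_sub]

theorem associator_shift_right (t : BinaryTree Unit) (x y z : ℕ → D) :
    associator (seriesProd B) t x y (shift z) = shift (associator (seriesProd B) t x y z) := by
  simp only [associator, seriesProd, seriesMul_shift_right, shift_sub]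

/-- The associator of `t` vanishes in degrees `≤ N` on constants. -/
def AssocUpTo (B : Side → ℕ → D →ₗ[K] D →ₗ[K] D) (N : ℕ) (t : BinaryTree Unit) : Prop :=
  ∀ a b c : D, ∀ n ≤ N,
    associator (seriesProd B) t (Pi.single 0 a) (Pi.single 0 b) (Pi.single 0 c) n = 0

/-- The coefficient of degree `N + 1` of the associator of constants. -/
def leadingAssociator (B : Side → ℕ → D →ₗ[K] D →ₗ[K] D) (N : ℕ) (t : BinaryTree Unit)
    (a b c : D) : D :=
  associator (seriesProd B) t (Pi.single 0 a) (Pi.single 0 b) (Pi.single 0 c) (N + 1)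

/-- Trilinearity over the formal parameter lets the slots be treated one at a time. Vanishing
through degree `N` spreads from constants to an arbitrary third argument, then to an arbitrary
second one; after that each argument can be replaced by its constant term. -/
theorem AssocUpTo.succ {N : ℕ} {t : BinaryTree Unit} (h : AssocUpTo B N t) (x y z : ℕ → D) :
    associator (seriesProd B) t x y z (N + 1)
      = leadingAssociator B N t (x 0) (y 0) (z 0) := by
  have hz : ∀ a b, ∀ z, ∀ n ≤ N,
      associator (seriesProd B) t (Pi.single 0 a) (Pi.single 0 b) z n = 0 := fun a b =>
    coeff_eq_zero_of_single _ (associator_add_right t _ _) (associator_shift_right t _ _) N (h a b)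
  have hyz : ∀ a, ∀ z y, ∀ n ≤ N,
      associator (seriesProd B) t (Pi.single 0 a) y z n = 0 := fun a z =>
    coeff_eq_zero_of_single (fun y => associator (seriesProd B) t (Pi.single 0 a) y z)
      (fun y y' => associator_add_middle t _ y y' _) (fun y => associator_shift_middle t _ y _) N
      (fun b => hz a b z)
  rw [coeff_succ_eq_single (fun x => associator (seriesProd B) t x y z)
      (fun x x' => associator_add_left t x x' _ _) (fun x => associator_shift_left t x _ _) N
      (fun a => hyz a z y),
    coeff_succ_eq_single (fun y => associator (seriesProd B) t (Pi.single 0 (x 0)) y z)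
      (fun y y' => associator_add_middle t _ y y' _) (fun y => associator_shift_middle t _ y _) N
      (fun b => hz (x 0) b z),
    coeff_succ_eq_single _ (associator_add_right t _ _) (associator_shift_right t _ _) N
      (h (x 0) (y 0)), leadingAssociator]

theorem leadingAssociator_cocycle {N : ℕ} (h : ∀ t, t.numNodes = 3 → AssocUpTo B N t)
    (t : BinaryTree Unit) (ht : t.numNodes = 4) (a b c d : D) :
    B (opFirst t) 0 a (leadingAssociator B N (deleteLeaf t 0) b c d)
      - leadingAssociator B N (deleteLeaf t 1) (B (opInner t 1) 0 a b) c d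
      + leadingAssociator B N (deleteLeaf t 2) a (B (opInner t 2) 0 b c) d
      - leadingAssociator B N (deleteLeaf t 3) a b (B (opInner t 3) 0 c d)
      + B (opLast t) 0 (leadingAssociator B N (deleteLeaf t 4) a b c) d = 0 := by
  have h' : ∀ i, AssocUpTo B N (deleteLeaf t i) := fun i =>
    h _ (by rw [numNodes_deleteLeaf, ht])
  have key := congrFun (associator_pentagon (seriesProd B) t ht (Pi.single 0 a) (Pi.single 0 b)
    (Pi.single 0 c) (Pi.single 0 d)) (N + 1)
  simp only [Pi.add_apply, Pi.sub_apply, (h' _).succ] at key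
  -- In the two outer terms the associator starts in degree `N + 1`, so only the degree-zero part of
  -- the outer product survives.
  rw [seriesProd, seriesProd, seriesProd, seriesProd, seriesProd,
    seriesMul_succ_of_right _ _ _ _ (h' 0 b c d), seriesMul_succ_of_left _ _ _ _ (h' 4 a b c)]
    at key
  simpa only [seriesMul_single_single, Pi.single_eq_same, (h' _).succ, Pi.zero_apply] using key

theorem homDefect_single (s : Side) (a b : D) (n : ℕ) :
    homDefect (seriesProd B) (seriesProd B') (seriesApply L) s (Pi.single 0 a) (Pi.single 0 b) n
      = ∑ p ∈ Finset.HasAntidiagonal.antidiagonal n,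
          ∑ q ∈ Finset.HasAntidiagonal.antidiagonal p.1, B' s q.1 (L q.2 a) (L p.2 b)
        - ∑ p ∈ Finset.HasAntidiagonal.antidiagonal n, L p.1 (B s p.2 a b) := by
  rw [homDefect, Pi.sub_apply, seriesProd, seriesProd, seriesMul_single_single,
    seriesApply_single, seriesApply_single, seriesMul_apply]
  simp only [seriesApply_apply, LinearMap.sum_apply]

/-- The coefficient of degree `N + 1` of the defect on constants. -/
def leadingDefect (B : Side → ℕ → D →ₗ[K] D →ₗ[K] D) (B' : Side → ℕ → E →ₗ[K] E →ₗ[K] E)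
    (L : ℕ → D →ₗ[K] E) (N : ℕ) (s : Side) (a b : D) : E :=
  homDefect (seriesProd B) (seriesProd B') (seriesApply L) s (Pi.single 0 a) (Pi.single 0 b)
    (N + 1)

variable {B' L}

/-- This is the coefficient of degree `N + 1` in `homDefect_square` on constants. -/
theorem leadingDefect_square {N : ℕ} (t : BinaryTree Unit) (ht : t.numNodes = 3)
    (h : AssocUpTo B N t) (h' : AssocUpTo B' N t)
    (hL : ∀ s, ∀ a b : D, ∀ n ≤ N, homDefect (seriesProd B) (seriesProd B') (seriesApply L) s
      (Pi.single 0 a) (Pi.single 0 b) n = 0) (a b c : D) :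
    B' (opFirst t) 0 (L 0 a) (leadingDefect B B' L N (sideOf (deleteLeaf t 0)) b c)
      - leadingDefect B B' L N (sideOf (deleteLeaf t 1)) (B (opInner t 1) 0 a b) c
      + leadingDefect B B' L N (sideOf (deleteLeaf t 2)) a (B (opInner t 2) 0 b c)
      - B' (opLast t) 0 (leadingDefect B B' L N (sideOf (deleteLeaf t 3)) a b) (L 0 c)
      = L 0 (leadingAssociator B N t a b c)
        - leadingAssociator B' N t (L 0 a) (L 0 b) (L 0 c) := by
  -- In each defect that occurs at least one argument is a constant, so reduction to constant terms
  -- is needed in one variable at a time only.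
  have hl : ∀ s, ∀ x : ℕ → D, ∀ b : D,
      homDefect (seriesProd B) (seriesProd B') (seriesApply L) s x (Pi.single 0 b) (N + 1)
        = leadingDefect B B' L N s (x 0) b := fun s x b =>
    coeff_succ_eq_single (fun x => homDefect (seriesProd B) (seriesProd B') (seriesApply L) s x
        (Pi.single 0 b))
      (fun x x' => by simp only [homDefect, map_add, LinearMap.add_apply]; abel)
      (fun x => by simp only [homDefect, seriesProd, seriesApply_shift_right,
        seriesMul_shift_left, shift_sub]) N (fun a => hL s a b) x
  have hr : ∀ s, ∀ a : D, ∀ y : ℕ → D,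
      homDefect (seriesProd B) (seriesProd B') (seriesApply L) s (Pi.single 0 a) y (N + 1)
        = leadingDefect B B' L N s a (y 0) := fun s a y =>
    coeff_succ_eq_single (fun y => homDefect (seriesProd B) (seriesProd B') (seriesApply L) s
        (Pi.single 0 a) y)
      (fun y y' => by simp only [homDefect, map_add]; abel)
      (fun y => by simp only [homDefect, seriesProd, seriesApply_shift_right,
        seriesMul_shift_right, shift_sub]) N (fun b => hL s a b) y
  have key := congrFun (homDefect_square (seriesProd B) (seriesProd B') (seriesApply L) t ht
    (Pi.single 0 a) (Pi.single 0 b) (Pi.single 0 c)) (N + 1)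
  simp only [Pi.add_apply, Pi.sub_apply, h'.succ, hl, hr] at key
  rw [seriesProd, seriesProd, seriesProd, seriesProd,
    seriesMul_succ_of_right _ _ _ _ (hL _ b c), seriesMul_succ_of_left _ _ _ _ (hL _ a b),
    seriesApply_succ_of_right _ _ _ (h a b c)] at key
  simpa only [seriesMul_single_single, seriesApply_single, Pi.single_eq_same, h.succ, hl]
    using key

end SeriesAssociator

/-! ### Evaluation of cochains -/

section Cochains

variable {K D M : Type*} [Field K] [AddCommGroup D] [Module K D] [AddCommGroup M] [Module K M]

theorem cochainOfPair_apply (F : Side → D →ₗ[K] D →ₗ[K] M) (y : Y 2) (a : Fin 2 → D) :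
    cochainOfPair F y a = F (sideOf y.1) (a 0) (a 1) := rfl

/-- The two insertions carry the signs $+1$ and $-1$, so this is one summand of the associator of a
three-node tree. -/
theorem preLie_cochainOfPair_apply (F G : Side → D →ₗ[K] D →ₗ[K] D) (y : Y 3) (a : Fin 3 → D) :
    preLie (m := 1) (n := 1) (cochainOfPair F) (cochainOfPair G) y a
      = F (sideOf (deleteLeaf y.1 1)) (G (sideOf (deleteLeaf y.1 3)) (a 0) (a 1)) (a 2)
        - F (sideOf (deleteLeaf y.1 2)) (a 0) (G (sideOf (deleteLeaf y.1 0)) (a 1) (a 2)) := by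
  rw [preLie, Fin.sum_univ_two]
  simp [insertAt, insertArgs, cochainOfPair_apply, Y.outer, Y.inner, sub_eq_add_neg]

variable [Dialgebra K D]

theorem coboundary_three_apply (ρ : Rep K D M) (f : CY K 3 D M) (y : Y 4) (a : Fin 4 → D) :
    coboundary ρ f y a
      = ρ.lact (opFirst y.1) (a 0) (f (y.d 0) ![a 1, a 2, a 3])
        - f (y.d 1) ![Dialgebra.mul (K := K) (opInner y.1 1) (a 0) (a 1), a 2, a 3]
        + f (y.d 2) ![a 0, Dialgebra.mul (K := K) (opInner y.1 2) (a 1) (a 2), a 3]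
        - f (y.d 3) ![a 0, a 1, Dialgebra.mul (K := K) (opInner y.1 3) (a 2) (a 3)]
        + ρ.ract (opLast y.1) (f (y.d 4) ![a 0, a 1, a 2]) (a 3) := by
  have e0 : (fun k : Fin 3 => a k.succ) = ![a 1, a 2, a 3] := by funext k; fin_cases k <;> rfl
  have e4 : (fun k : Fin 3 => a k.castSucc) = ![a 0, a 1, a 2] := by
    funext k; fin_cases k <;> rfl
  have e1 (B : D →ₗ[K] D →ₗ[K] D) :
      insertArgs (m := 3) (p := 2) (N := 4) rfl (bilin B) 0 a
        = ![B (a 0) (a 1), a 2, a 3] := by funext k; fin_cases k <;> rfl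
  have e2 (B : D →ₗ[K] D →ₗ[K] D) :
      insertArgs (m := 3) (p := 2) (N := 4) rfl (bilin B) 1 a
        = ![a 0, B (a 1) (a 2), a 3] := by funext k; fin_cases k <;> rfl
  have e3 (B : D →ₗ[K] D →ₗ[K] D) :
      insertArgs (m := 3) (p := 2) (N := 4) rfl (bilin B) 2 a
        = ![a 0, a 1, B (a 2) (a 3)] := by funext k; fin_cases k <;> rfl
  rw [coboundary, Fin.sum_univ_three, ← e0, ← e1, ← e2, ← e3, ← e4]
  have h3 : (-1 : K) ^ 3 = -1 := by norm_num
  have h4 : (-1 : K) ^ 4 = 1 := by norm_num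
  simp [insertAt, actLeft, actRight, sub_eq_add_neg, add_assoc, h3, h4]

theorem coboundary_two_apply (ρ : Rep K D M) (f : CY K 2 D M) (y : Y 3) (a : Fin 3 → D) :
    coboundary ρ f y a
      = ρ.lact (opFirst y.1) (a 0) (f (y.d 0) ![a 1, a 2])
        - f (y.d 1) ![Dialgebra.mul (K := K) (opInner y.1 1) (a 0) (a 1), a 2]
        + f (y.d 2) ![a 0, Dialgebra.mul (K := K) (opInner y.1 2) (a 1) (a 2)]
        - ρ.ract (opLast y.1) (f (y.d 3) ![a 0, a 1]) (a 2) := by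
  have e0 : (fun k : Fin 2 => a k.succ) = ![a 1, a 2] := by funext k; fin_cases k <;> rfl
  have e4 : (fun k : Fin 2 => a k.castSucc) = ![a 0, a 1] := by funext k; fin_cases k <;> rfl
  have e1 (B : D →ₗ[K] D →ₗ[K] D) :
      insertArgs (m := 2) (p := 2) (N := 3) rfl (bilin B) 0 a
        = ![B (a 0) (a 1), a 2] := by funext k; fin_cases k <;> rfl
  have e2 (B : D →ₗ[K] D →ₗ[K] D) :
      insertArgs (m := 2) (p := 2) (N := 3) rfl (bilin B) 1 a
        = ![a 0, B (a 1) (a 2)] := by funext k; fin_cases k <;> rfl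
  rw [coboundary, Fin.sum_univ_two, ← e0, ← e1, ← e2, ← e4]
  simp [insertAt, actLeft, actRight, sub_eq_add_neg, add_assoc, pow_succ]

end Cochains

/-! ### Deformations -/

section Deformations

variable {K D E : Type*} [Field K] [AddCommGroup D] [Module K D] [Dialgebra K D]
  [AddCommGroup E] [Module K E] [Dialgebra K E] {N : ℕ}

/-- The coefficients of the deformed products. -/
def DialgebraDeformation.coeffs (f : DialgebraDeformation K D N) (s : Side) (n : ℕ) :
    D →ₗ[K] D →ₗ[K] D := f.F n s

theorem DialgebraDeformation.coeffs_zero (f : DialgebraDeformation K D N) (s : Side) :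
    f.coeffs s 0 = Dialgebra.mul s := by rw [coeffs, f.F_zero]

/-- By `axiomSides`, each tree with three nodes selects one of the five deformed axioms. -/
theorem DialgebraDeformation.assocUpTo (f : DialgebraDeformation K D N) (t : BinaryTree Unit)
    (ht : t.numNodes = 3) : AssocUpTo f.coeffs N t := by
  intro a b c n hn
  rw [associator_seriesProd_single, Finset.sum_sub_distrib, sub_eq_zero]
  have key := axiomSides t ht
  simp only [List.mem_cons, Prod.mk.injEq, List.not_mem_nil, or_false] at key
  obtain ⟨h1, h2, h3, h4⟩ | ⟨h1, h2, h3, h4⟩ | ⟨h1, h2, h3, h4⟩ | ⟨h1, h2, h3, h4⟩ |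
    ⟨h1, h2, h3, h4⟩ := key <;> rw [h1, h2, h3, h4]
  · exact (f.axiom₁ n hn a b c).symm
  · exact f.axiom₂ n hn a b c
  · exact f.axiom₃ n hn a b c
  · exact f.axiom₄ n hn a b c
  · exact (f.axiom₅ n hn a b c).symm

theorem DialgebraDeformation.ob_apply (f : DialgebraDeformation K D N) (y : Y 3)
    (a : Fin 3 → D) : f.ob y a = leadingAssociator f.coeffs N y.1 (a 0) (a 1) (a 2) := by
  rw [leadingAssociator, associator_seriesProd_single, DialgebraDeformation.ob, Finset.sum_apply,
    sum_apply]
  simp only [preLie_cochainOfPair_apply]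
  -- The full convolution adds only terms with an index 0. Their other index is `N + 1`, where the
  -- truncated deformation has coefficient zero.
  refine Finset.sum_subset (Finset.filter_subset _ _) fun p hp hp' => ?_
  rw [Finset.HasAntidiagonal.mem_antidiagonal] at hp
  simp only [Finset.mem_filter, Finset.HasAntidiagonal.mem_antidiagonal, hp, true_and,
    not_and_or, not_lt, nonpos_iff_eq_zero] at hp'
  obtain h | h := hp'
  · have h2 : f.F p.2 = 0 := f.F_eq_zero _ (by omega)
    simp [h2]
  · have h1 : f.F p.1 = 0 := f.F_eq_zero _ (by omega)
    simp [h1]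

theorem DialgebraDeformation.coboundary_ob (f : DialgebraDeformation K D N) :
    coboundary (Rep.self K D) f.ob = 0 := by
  funext y
  ext a
  have key := leadingAssociator_cocycle (B := f.coeffs) f.assocUpTo y.1 y.2
    (a 0) (a 1) (a 2) (a 3)
  simp only [f.coeffs_zero] at key
  rw [coboundary_three_apply]
  simp only [f.ob_apply]
  exact key

/-- Converts the threefold index of the morphism condition into the nested convolutions produced by
`seriesMul`. -/
theorem sum_triples {A : Type*} [AddCommMonoid A] (n : ℕ) (g : ℕ × ℕ × ℕ → A) :
    ∑ p ∈ triples n, g p = ∑ p ∈ Finset.HasAntidiagonal.antidiagonal n,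
      ∑ q ∈ Finset.HasAntidiagonal.antidiagonal p.1, g (q.1, q.2, p.2) := by
  rw [Finset.sum_sigma']
  refine Finset.sum_bij' (fun p _ => ⟨(p.1 + p.2.1, p.2.2), (p.1, p.2.1)⟩)
    (fun r _ => (r.2.1, r.2.2, r.1.2)) ?_ ?_ ?_ ?_ ?_
  · rintro ⟨i, j, k⟩ h
    simp only [triples, Finset.mem_filter] at h
    simp [h.2]
  · rintro ⟨⟨i, j⟩, ⟨k, l⟩⟩ h
    simp only [Finset.mem_sigma, Finset.HasAntidiagonal.mem_antidiagonal] at h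
    simp only [triples, Finset.mem_filter, Finset.mem_product, Finset.mem_range]
    omega
  · rintro ⟨i, j, k⟩ h
    rfl
  · rintro ⟨⟨i, j⟩, ⟨k, l⟩⟩ h
    simp only [Finset.mem_sigma, Finset.HasAntidiagonal.mem_antidiagonal] at h
    obtain ⟨-, rfl⟩ := h
    rfl
  · rintro ⟨i, j, k⟩ h
    rfl

variable {ψ : DialgebraHom K D E} (Θ : MorDeformation ψ N)

theorem MorDeformation.homDefect_single_eq (s : Side) (a b : D) (n : ℕ) :
    homDefect (seriesProd Θ.defD.coeffs) (seriesProd Θ.defE.coeffs) (seriesApply Θ.psi) s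
      (Pi.single 0 a) (Pi.single 0 b) n
      = ∑ p ∈ triples n, Θ.defE.F p.1 s (Θ.psi p.2.1 a) (Θ.psi p.2.2 b)
        - ∑ p ∈ Finset.HasAntidiagonal.antidiagonal n, Θ.psi p.1 (Θ.defD.F p.2 s a b) := by
  rw [homDefect_single, sum_triples]
  rfl

theorem MorDeformation.obPsi_apply (y : Y 2) (a : Fin 2 → D) :
    Θ.obPsi y a
      = leadingDefect Θ.defD.coeffs Θ.defE.coeffs Θ.psi N (sideOf y.1) (a 0) (a 1) := by
  rw [leadingDefect, Θ.homDefect_single_eq, MorDeformation.obPsi, cochainOfPair_apply]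
  simp only [LinearMap.sub_apply, LinearMap.sum_apply, LinearMap.compl₁₂_apply,
    LinearMap.compr₂_apply]
  congr 1
  · refine Finset.sum_subset (Finset.filter_subset _ _) ?_
    rintro ⟨i, j, k⟩ hp hp'
    simp only [primedTriples, Finset.mem_filter, hp, true_and] at hp'
    simp only [triples, Finset.mem_filter] at hp
    -- A triple outside the primed sum has two zero entries, so the third is `N + 1` and its factor
    -- vanishes.
    have hcases : N < i ∨ N < j ∨ N < k := by omega
    obtain h | h | h := hcases
    · simp [Θ.defE.F_eq_zero _ h]
    · simp [Θ.psi_eq_zero _ h]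
    · simp [Θ.psi_eq_zero _ h]
  · rw [Finset.Nat.sum_antidiagonal_eq_sum_range_succ
      (fun i j => Θ.psi i (Θ.defD.F j (sideOf y.1) (a 0) (a 1)))]
    -- The end terms `i = 0` and `i = N + 1` contain `F (N + 1)` and `psi (N + 1)` respectively,
    -- both zero.
    refine Finset.sum_subset (fun i hi => ?_) fun i hi hi' => ?_
    · simp only [Finset.mem_Icc, Finset.mem_range] at hi ⊢; omega
    · simp only [Finset.mem_Icc, Finset.mem_range] at hi hi'
      have hcases : i = 0 ∨ N < i := by omega
      obtain rfl | h := hcases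
      · simp [Θ.defD.F_eq_zero (N + 1) (by omega)]
      · simp [Θ.psi_eq_zero _ h]

/-- The defect identity in degree `N + 1`, with both associators recognised as the obstructions of
the two dialgebras. -/
theorem MorDeformation.coboundary_obPsi :
    coboundary ψ.rep Θ.obPsi
      = pushLeft ψ.toLin Θ.defD.ob - pushRight ψ.toLin Θ.defE.ob := by
  funext y
  ext a
  have key := leadingDefect_square (L := Θ.psi) y.1 y.2 (Θ.defD.assocUpTo y.1 y.2)
    (Θ.defE.assocUpTo y.1 y.2) (fun s a b n hn => by
      rw [Θ.homDefect_single_eq, Θ.map_mul n hn, sub_self]) (a 0) (a 1) (a 2)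
  simp only [Θ.defD.coeffs_zero, Θ.defE.coeffs_zero, Θ.psi_zero] at key
  rw [coboundary_two_apply]
  simp only [Θ.obPsi_apply]
  refine key.trans ?_
  simp [pushLeft, pushRight, DialgebraDeformation.ob_apply]

end Deformations

end YauDialg

theorem lemma6p1 {K D E : Type*} [Field K]
    [AddCommGroup D] [Module K D] [YauDialg.Dialgebra K D]
    [AddCommGroup E] [Module K E] [YauDialg.Dialgebra K E]
    (ψ : YauDialg.DialgebraHom K D E) (N : ℕ) (hN : 0 < N)
    (Θ : YauDialg.MorDeformation ψ N) :
    YauDialg.IsCocycle ψ (n := 3) Θ.ob := by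
  refine Prod.ext Θ.defD.coboundary_ob (Prod.ext Θ.defE.coboundary_ob ?_)
  -- In degree 3 the last factor of the complex reduces definitionally to 2-cochains with their
  -- usual coboundary.
  show YauDialg.pushLeft ψ.toLin Θ.defD.ob - YauDialg.pushRight ψ.toLin Θ.defE.ob
    - YauDialg.coboundary ψ.rep Θ.obPsi = 0
  rw [Θ.coboundary_obPsi, sub_self]
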